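/- Let $v\ge 3$. A binary design with block size $2$ on the treatments $1,\dots,v$ is a finite family of blocks, repetitions allowed, each of which is a set of two distinct treatments. For such a design $d$ let $r_i$ be the number of blocks containing $i$, let $N_d$ be the $0/1$ treatment-block incidence matrix, let $C_d=\mathrm{diag}(r_1,\dots,r_v)-\tfrac12N_dN_d^T$ be the information matrix, and let $L_d=2C_d$ be the Laplacian matrix, that is, the Laplacian of the concurrence (multi)graph. The design is connected if all pairwise treatment differences $\tau_p-\tau_q$ are estimable in the additive treatment-plus-block model; then the $v-1$ non-trivial eigenvalues of $C_d$ (all but one eigenvalue $0$) are positive. Within a class of connected designs, a design of the class is $D$-optimal if it minimizes the product of the reciprocals of the non-trivial eigenvalues of $C_d$, and $A$-optimal if it minimizes the sum of these reciprocals. Let $\mathcal L(v,v-1,2)$ be the set of Laplacian matrices of connected binary designs with $v$ treatments and $v-1$ blocks of size $2$, and let $\mathcal L_1(v,v-1,2)$ be the set of those $L\in\mathcal L(v,v-1,2)$ whose sum of non-trivial eigenvalues is maximal in $\mathcal L(v,v-1,2)$. Let $\tilde d$ be a BIBD (balanced incomplete block design) on $v$ treatments with block size $2$ and concurrence parameter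 $\tilde\lambda\ge 1$. For $y\in\mathbb N=\{0,1,2,\dots\}$ write $L[y]=L+yL_{\tilde d}$ for the Laplacian matrix of the design obtained by adding the blocks of $\tilde d$ to a design with Laplacian matrix $L$ a total of $y$ times. Let $Path(v)$ be a path through all $v$ treatments, in any order. Proposition. For every $y\ge 0$, any binary design with block size $2$ and Laplacian matrix $L(Path(v))[y]$ is $D$-optimal among the connected binary designs with block size $2$ and Laplacian matrix $L[y]$ for some $L\in\mathcal L_1(v,v-1,2)$. For every $y\ge 1$ it is also $A$-optimal among these designs. -/

import Mathlib

open scoped Matrix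

noncomputable section

/-- A binary block design on the `v` treatments `Fin v`: a finite family of blocks of size `k`,
in which every treatment occurs at most once per block. Blocks may be repeated. -/
structure BinaryDesign (v k : ℕ) where
  /-- the number of blocks -/
  numBlocks : ℕ
  /-- the set of treatments of each block -/
  block : Fin numBlocks → Finset (Fin v)
  card_block : ∀ j, (block j).card = k

namespace BinaryDesign

variable {v k : ℕ}

/-- The replication of the treatment `i`: the number of units to which `i` is assigned. -/
def replication (d : BinaryDesign v k) (i : Fin v) : ℕ :=
  (Finset.univ.filter fun j => i ∈ d.block j).card

/-- The treatment-block incidence matrix `N_d`. -/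
def incidence (d : BinaryDesign v k) : Matrix (Fin v) (Fin d.numBlocks) ℝ :=
  Matrix.of fun i j => if i ∈ d.block j then 1 else 0

/-- The matrix `N_d N_dᵀ` of the concurrences. -/
def concurrence (d : BinaryDesign v k) : Matrix (Fin v) (Fin v) ℝ :=
  d.incidence * d.incidenceᵀ

/-- The information matrix `C_d = diag(r_1, …, r_v) - (1/k) N_d N_dᵀ`. -/
def informationMatrix (d : BinaryDesign v k) : Matrix (Fin v) (Fin v) ℝ :=
  Matrix.diagonal (fun i => (d.replication i : ℝ)) - (1 / (k : ℝ)) • d.concurrence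

/-- The Laplacian matrix `L_d = k diag(r_1, …, r_v) - N_d N_dᵀ`. -/
def laplacian (d : BinaryDesign v k) : Matrix (Fin v) (Fin v) ℝ :=
  (k : ℝ) • Matrix.diagonal (fun i => (d.replication i : ℝ)) - d.concurrence

/-- The contrast `τ_p - τ_q` is estimable in the additive model, in which the unit of block `j`
with treatment `i` has mean response `τ i + β j`: some linear combination of the responses has
mean `τ p - τ q`, whatever the treatment effects `τ` and the block effects `β`. -/
def DifferenceEstimable (d : BinaryDesign v k) (p q : Fin v) : Prop :=
  ∃ a : Fin d.numBlocks → Fin v → ℝ, ∀ (τ : Fin v → ℝ) (β : Fin d.numBlocks → ℝ),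
    ∑ j, ∑ i ∈ d.block j, a j i * (τ i + β j) = τ p - τ q

/-- A design is connected if all pairwise treatment differences are estimable. -/
def Connected (d : BinaryDesign v k) : Prop :=
  ∀ p q : Fin v, d.DifferenceEstimable p q

/-- `d` is a balanced incomplete block design in which any two treatments are together in exactly
`lam` blocks. -/
structure IsBIBD (d : BinaryDesign v k) (lam : ℕ) : Prop where
  lt : k < v
  pos : 0 < lam
  replication_mul : ∀ i, d.replication i * v = d.numBlocks * k
  concurrence_eq : ∀ i j, i ≠ j → d.concurrence i j = (lam : ℝ)

end BinaryDesign

/-- The non-trivial eigenvalues, with multiplicity, of a symmetric real matrix with row sums zero: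
all roots of the characteristic polynomial except for one copy of the eigenvalue `0`, which
belongs to the all-one vector. -/
def nontrivialEigenvalues {v : ℕ} (M : Matrix (Fin v) (Fin v) ℝ) : Multiset ℝ :=
  M.charpoly.roots.erase 0

/-- The value of the `A`-criterion (to be minimized): the reciprocal of the harmonic mean of the
`v - 1` non-trivial eigenvalues of the information matrix. It is proportional to the average
variance of the best linear unbiased estimators of the pairwise treatment differences. -/
def aCriterion {v k : ℕ} (d : BinaryDesign v k) : ℝ :=
  ((nontrivialEigenvalues d.informationMatrix).map fun ρ => ρ⁻¹).sum / ((v : ℝ) - 1)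

/-- The value of the `D`-criterion (to be minimized): the product of the reciprocals of the
non-trivial eigenvalues of the information matrix. -/
def dCriterion {v k : ℕ} (d : BinaryDesign v k) : ℝ :=
  ((nontrivialEigenvalues d.informationMatrix).map fun ρ => ρ⁻¹).prod

/-- `d` is `A`-optimal among the (connected) designs of the class `K`. -/
def IsAOptimalAmong {v k : ℕ} (K : Set (BinaryDesign v k)) (d : BinaryDesign v k) : Prop :=
  d ∈ K ∧ ∀ d' ∈ K, aCriterion d ≤ aCriterion d'

/-- `d` is `D`-optimal among the (connected) designs of the class `K`. -/
def IsDOptimalAmong {v k : ℕ} (K : Set (BinaryDesign v k)) (d : BinaryDesign v k) : Prop :=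
  d ∈ K ∧ ∀ d' ∈ K, dCriterion d ≤ dCriterion d'

/-- `𝓛(v,b,k)`: the Laplacian matrices of the connected binary designs with `v` treatments and
`b` blocks of size `k`. -/
def designLaplacians (v b k : ℕ) : Set (Matrix (Fin v) (Fin v) ℝ) :=
  {L | ∃ d : BinaryDesign v k, d.numBlocks = b ∧ d.Connected ∧ d.laplacian = L}

/-- `𝓛_i(v,b,k)`: the matrices in `𝓛(v,b,k)` whose non-trivial eigenvalues maximize the elementary
symmetric polynomials `S_1, …, S_i` over `𝓛(v,b,k)`. -/
def maximalDesignLaplacians (i v b k : ℕ) : Set (Matrix (Fin v) (Fin v) ℝ) :=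
  {L | L ∈ designLaplacians v b k ∧ ∀ j, 1 ≤ j → j ≤ i → ∀ L' ∈ designLaplacians v b k,
    (nontrivialEigenvalues L').esymm j ≤ (nontrivialEigenvalues L).esymm j}

/-- `L[y] = L + y L_e`, the Laplacian matrix of a design with Laplacian matrix `L` to which the
blocks of the BIBD `e` have been added `y` times. -/
def bibdExtension {v k : ℕ} (e : BinaryDesign v k) (y : ℕ) (L : Matrix (Fin v) (Fin v) ℝ) :
    Matrix (Fin v) (Fin v) ℝ :=
  L + (y : ℝ) • e.laplacian

/-- The connected binary designs with Laplacian matrix `L[y]` for some `L ∈ 𝓛_1(v,b,k)`. -/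
def connectedExtendedDesigns {v k : ℕ} (b : ℕ) (e : BinaryDesign v k) (y : ℕ) :
    Set (BinaryDesign v k) :=
  {d | d.Connected ∧ ∃ L ∈ maximalDesignLaplacians 1 v b k, d.laplacian = bibdExtension e y L}

open Classical in
/-- The Laplacian matrix of the path with vertices `w 0, …, w (v - 1)`, in this order. -/
def pathLaplacian {v : ℕ} (w : Equiv.Perm (Fin v)) : Matrix (Fin v) (Fin v) ℝ :=
  ((SimpleGraph.pathGraph v).map w.toEmbedding).lapMatrix ℝ

end

/-!
The Laplacian matrix of a connected design with `v - 1` blocks of size two is that of a tree with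
`v` vertices (`BinaryDesign.isTree_graph`), and its trace is always `2 (v - 1)`, so that every such
design maximizes the sum of the non-trivial eigenvalues (`maximalDesignLaplacians_one`). Adding a
balanced design `y` times shifts the non-trivial eigenvalues `μ` of the tree by `t = y λ v`
(`nontrivialEigenvalues_half_add`). Both criteria can therefore be read off the polynomial
`p = ∏ (X + μ)` at `t`: up to constant factors they are `1 / p(t)` and `p'(t) / p(t)`.

The main point is that the path has, coefficient by coefficient, the largest `p` among all trees.
It is proved for rooted trees, together with the same bound for the minor `B` of the determinant
`P = det (X + L) = X p` in which the row and the column of the root are deleted. If two rooted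
trees are joined by an edge between their roots, and the first root is kept, then
`P = P₁ (P₂ + B₂) + B₁ P₂` and `B = B₁ (P₂ + B₂)`. These formulas are monotone, and the pairs of
paths, rooted at an end, are submultiplicative in the sense needed (`pathPair_snd_mul_le`), so the
bounds are inherited (`PathBounded.join`). A tree is taken apart by removing a leaf and merging its
pair into that of its neighbour, which does not change the weighted determinant
(`det_weightedLaplacian_option`); this yields the bound (`det_weightedLaplacian_tree`), with
equality for the path (`det_weightedLaplacian_path`).

For the `D`-criterion evaluation at `t ≥ 0` suffices. For the `A`-criterion the difference `δ` of
the polynomials of the path and of another tree has non-negative coefficients and, the traces being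
equal, degree at most `v - 3`. Hence the logarithmic derivative of `δ` at `t` is at most
`(v - 3) / t`, and that of `p` is at least this if `t ≥ v - 1`, which `y ≥ 1` ensures
(`sum_inv_add_le`).
-/

open Polynomial

/-! ### Coefficientwise comparison of polynomials -/

/-- Coefficientwise order on real polynomials. -/
def CoeffLE (p q : ℝ[X]) : Prop := ∀ i, p.coeff i ≤ q.coeff i

namespace CoeffLE

variable {p q r p' q' : ℝ[X]}

theorem refl (p : ℝ[X]) : CoeffLE p p := fun _ => le_rfl

theorem trans (h : CoeffLE p q) (h' : CoeffLE q r) : CoeffLE p r := fun i => (h i).trans (h' i)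

theorem add (h : CoeffLE p q) (h' : CoeffLE p' q') : CoeffLE (p + p') (q + q') := fun i => by
  simpa using add_le_add (h i) (h' i)

theorem mul_nonneg (hp : CoeffLE 0 p) (hq : CoeffLE 0 q) : CoeffLE 0 (p * q) := fun i => by
  rw [coeff_mul, coeff_zero]
  exact Finset.sum_nonneg fun x _ =>
    _root_.mul_nonneg (by simpa using hp x.1) (by simpa using hq x.2)

theorem mul (h : CoeffLE p q) (h' : CoeffLE p' q') (hp : CoeffLE 0 p) (hp' : CoeffLE 0 p') :
    CoeffLE (p * p') (q * q') := fun i => by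
  rw [coeff_mul, coeff_mul]
  refine Finset.sum_le_sum fun x _ => mul_le_mul (h _) (h' _) (by simpa using hp' x.2) ?_
  exact le_trans (by simpa using hp x.1) (h _)

theorem one_nonneg : CoeffLE 0 1 := fun i => by
  rw [coeff_one, coeff_zero]; split_ifs <;> simp

theorem X_nonneg : CoeffLE 0 X := fun i => by
  rw [coeff_X, coeff_zero]; split_ifs <;> simp

theorem le_add_right (h : CoeffLE p q) (hr : CoeffLE 0 r) : CoeffLE p (q + r) := by
  simpa using h.add hr

theorem add_nonneg (hp : CoeffLE 0 p) (hq : CoeffLE 0 q) : CoeffLE 0 (p + q) := by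
  simpa using hp.add hq

theorem eval_nonneg (h : CoeffLE 0 p) {t : ℝ} (ht : 0 ≤ t) : 0 ≤ p.eval t := by
  rw [eval_eq_sum_range]
  exact Finset.sum_nonneg fun i _ => _root_.mul_nonneg (by simpa using h i) (pow_nonneg ht i)

theorem sub_nonneg (h : CoeffLE p q) : CoeffLE 0 (q - p) := fun i => by simpa using h i

theorem eval_le (h : CoeffLE p q) {t : ℝ} (ht : 0 ≤ t) : p.eval t ≤ q.eval t := by
  simpa using h.sub_nonneg.eval_nonneg ht

end CoeffLE

/-! ### The Laplacian polynomials of paths -/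

/-- The pair `(g, b)` for the path with `n` vertices and Laplacian matrix `L`: the characteristic
determinant `det (X + L)` is `X * g`, and `b` is the minor of `X + L` in which the row and the
column of an end vertex are deleted. The value at `n = 0` is chosen to fit the recursion. -/
noncomputable def pathPair : ℕ → ℝ[X] × ℝ[X]
  | 0 => (0, 1)
  | n + 1 => ((X + 1) * (pathPair n).1 + (pathPair n).2, X * (pathPair n).1 + (pathPair n).2)

theorem pathPair_fst_succ (n : ℕ) :
    (pathPair (n + 1)).1 = (X + 1) * (pathPair n).1 + (pathPair n).2 := rfl

theorem pathPair_snd_succ (n : ℕ) :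
    (pathPair (n + 1)).2 = X * (pathPair n).1 + (pathPair n).2 := rfl

theorem pathPair_one : pathPair 1 = (1, 1) := by simp [pathPair]

theorem pathPair_nonneg (n : ℕ) : CoeffLE 0 (pathPair n).1 ∧ CoeffLE 0 (pathPair n).2 := by
  induction n with
  | zero => exact ⟨.refl _, .one_nonneg⟩
  | succ n ih =>
    have hX := CoeffLE.X_nonneg
    exact ⟨.add_nonneg (.mul_nonneg (.add_nonneg hX .one_nonneg) ih.1) ih.2,
      .add_nonneg (.mul_nonneg hX ih.1) ih.2⟩

theorem one_le_pathPair_snd (n : ℕ) : CoeffLE 1 (pathPair n).2 := by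
  induction n with
  | zero => exact .refl _
  | succ n ih =>
    rw [pathPair_snd_succ, add_comm]
    exact ih.le_add_right (.mul_nonneg .X_nonneg (pathPair_nonneg n).1)

/-- Joining the ends of two paths by an edge. -/
theorem pathPair_add (m n : ℕ) :
    (pathPair (m + n)).1 = (X * (pathPair n).1 + (pathPair n).2) * (pathPair m).1 +
        (pathPair n).1 * (pathPair m).2 ∧
      (pathPair (m + n)).2 =
        X * (pathPair m).1 * (pathPair n).1 + (pathPair m).2 * (pathPair n).2 := by
  induction n with
  | zero => simp [pathPair]
  | succ n ih =>
    simp only [← add_assoc, pathPair_fst_succ, pathPair_snd_succ, ih.1, ih.2]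
    constructor <;> ring

/-- Attaching a path by its end to the end of another path gives a larger rooted minor than
attaching it to the root of a path as a second branch. -/
theorem pathPair_snd_mul_le {m : ℕ} (hm : 1 ≤ m) (n : ℕ) :
    CoeffLE ((pathPair m).2 * (X * (pathPair n).1 + (pathPair n).2)) (pathPair (m + n)).2 := by
  obtain ⟨m, rfl⟩ := Nat.exists_eq_add_of_le' hm
  rw [add_right_comm, pathPair_snd_succ, pathPair_snd_succ, (pathPair_add m n).1,
    (pathPair_add m n).2]
  have h : X * ((X * (pathPair n).1 + (pathPair n).2) * (pathPair m).1 +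
        (pathPair n).1 * (pathPair m).2) +
      (X * (pathPair m).1 * (pathPair n).1 + (pathPair m).2 * (pathPair n).2) =
      (X * (pathPair m).1 + (pathPair m).2) * (X * (pathPair n).1 + (pathPair n).2) +
        X * ((pathPair m).1 * (pathPair n).1) := by ring
  rw [h]
  exact (CoeffLE.refl _).le_add_right
    (.mul_nonneg .X_nonneg (.mul_nonneg (pathPair_nonneg m).1 (pathPair_nonneg n).1))

/-- The pair `(P, B)` of polynomials lies between the pair of a single vertex and the pair of a path
with `s ≥ 1` vertices. The lower bounds keep all coefficients non-negative and, in the end, the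
non-trivial Laplacian eigenvalues positive. -/
structure PathBounded (P B : ℝ[X]) (s : ℕ) : Prop where
  one_le : 1 ≤ s
  X_le : CoeffLE X P
  one_le_snd : CoeffLE 1 B
  le_fst : CoeffLE P (X * (pathPair s).1)
  le_snd : CoeffLE B (pathPair s).2

namespace PathBounded

variable {P B P' B' : ℝ[X]} {s s' : ℕ}

theorem single : PathBounded X 1 1 := by
  constructor <;> simp [pathPair_one, CoeffLE.refl]

theorem fst_nonneg (h : PathBounded P B s) : CoeffLE 0 P := CoeffLE.X_nonneg.trans h.X_le

theorem snd_nonneg (h : PathBounded P B s) : CoeffLE 0 B := CoeffLE.one_nonneg.trans h.one_le_snd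

theorem add_ne_zero (h : PathBounded P B s) : P + B ≠ 0 := fun h0 => by
  have h1 := h.one_le_snd 0
  have h2 := h.fst_nonneg 0
  have h3 := congrArg (coeff · 0) h0
  simp only [coeff_add, coeff_zero, coeff_one_zero] at h1 h2 h3
  linarith

/-- The bounds are preserved when two rooted trees are joined by an edge between their roots. -/
theorem join (h : PathBounded P B s) (h' : PathBounded P' B' s') :
    PathBounded (P * (P' + B') + B * P') (B * (P' + B')) (s + s') where
  one_le := h.one_le.trans (Nat.le_add_right _ _)
  X_le := by
    have h1 : CoeffLE (1 * X) (B * P') :=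
      h.one_le_snd.mul h'.X_le .one_nonneg .X_nonneg
    rw [one_mul] at h1
    rw [add_comm]
    exact h1.le_add_right (.mul_nonneg h.fst_nonneg (.add_nonneg h'.fst_nonneg h'.snd_nonneg))
  one_le_snd := by
    have h1 : CoeffLE (1 * 1) (B * (B' + P')) :=
      h.one_le_snd.mul (h'.one_le_snd.le_add_right h'.fst_nonneg) .one_nonneg .one_nonneg
    rwa [one_mul, add_comm B'] at h1
  le_fst := by
    have h1 := (h.le_fst.mul (h'.le_fst.add h'.le_snd) h.fst_nonneg
      (.add_nonneg h'.fst_nonneg h'.snd_nonneg)).add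
      (h.le_snd.mul h'.le_fst h.snd_nonneg h'.fst_nonneg)
    convert h1 using 1
    rw [(pathPair_add s s').1]
    ring
  le_snd := (h.le_snd.mul (h'.le_fst.add h'.le_snd) h.snd_nonneg
      (.add_nonneg h'.fst_nonneg h'.snd_nonneg)).trans (pathPair_snd_mul_le h.one_le s')

end PathBounded

/-! ### Elimination of a leaf from a weighted Laplacian determinant -/

section WeightedLaplacian

variable {V R : Type*} [Fintype V] [DecidableEq V] [CommRing R]

/-- The matrix `diag P + L diag B`, where `L` is the Laplacian matrix with edge weights `A`. If
`(P i, B i)` is the pair of a tree with root `i`, its determinant is the one that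
belongs to the graph in which such a tree is hung on each vertex `i`. -/
def weightedLaplacian (A : V → V → R) (P B : V → R) : Matrix V V R :=
  Matrix.of fun i j => (if i = j then P i + (∑ k, A i k) * B i else 0) - A i j * B j

/-- A leaf `none` with pair `(p, b)`, attached to the vertex `u`, can be deleted if the pair of `u`
is changed to that of the tree in which the roots `u` and `none` are joined by an edge. -/
theorem det_weightedLaplacian_option [IsDomain R] (A : V → V → R) (A' : Option V → Option V → R)
    (u : V) (hA : ∀ a b, A' (some a) (some b) = A a b)
    (hl : ∀ a, A' none (some a) = if a = u then 1 else 0)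
    (hr : ∀ a, A' (some a) none = if a = u then 1 else 0) (P B : Option V → R)
    (h0 : P none + B none ≠ 0) :
    (weightedLaplacian A' P B).det =
      (weightedLaplacian A
        (Function.update (fun i => P (some i)) u
          (P (some u) * (P none + B none) + B (some u) * P none))
        (Function.update (fun i => B (some i)) u (B (some u) * (P none + B none)))).det := by
  set N := weightedLaplacian A' P B with hN
  set M := weightedLaplacian A (Function.update (fun i => P (some i)) u
          (P (some u) * (P none + B none) + B (some u) * P none))
        (Function.update (fun i => B (some i)) u (B (some u) * (P none + B none))) with hM
  -- This combination of the columns of `u` and of the leaf vanishes in the row of the leaf.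
  set N' := (N.updateCol (some u) ((P none + B none) • fun i => N i (some u))).updateCol (some u)
    (fun i => ((P none + B none) • fun i => N i (some u)) i + B (some u) * N i none) with hN'
  have h1 : N'.det = (P none + B none) * N.det := by
    have := Matrix.det_updateCol_add_smul_self
      (N.updateCol (some u) ((P none + B none) • fun i => N i (some u)))
      (i := some u) (j := none) (by simp) (B (some u))
    rw [Matrix.det_updateCol_smul] at this
    have h2 : N.updateCol (some u) (fun i => N i (some u)) = N := by
      ext i j; simp [Matrix.updateCol_apply]; rintro rfl; rfl
    rw [h2] at this
    rw [← this, hN']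
    congr 1
    ext i j
    simp [Matrix.updateCol_apply]
  have h2 : N'.submatrix (Equiv.optionEquivSumPUnit.{0} V).symm
        (Equiv.optionEquivSumPUnit.{0} V).symm =
      Matrix.fromBlocks M (Matrix.of fun i _ => N (some i) none) 0
        (Matrix.of fun _ _ => P none + B none) := by
    ext (i | i) (j | j)
    · by_cases hj : j = u
      · subst hj
        by_cases hi : i = j
        · subst hi
          simp [hN', hN, hM, weightedLaplacian, hA, hr, Fintype.sum_option]
          ring
        · simp [hN', hN, hM, weightedLaplacian, hA, hr, hi]
          ring
      · by_cases hi : i = j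
        · subst hi
          simp [hN', hN, hM, weightedLaplacian, hA, hr, hj, Fintype.sum_option]
        · simp [hN', hN, hM, weightedLaplacian, hA, hj, hi]
    · simp [hN']
    · by_cases hj : j = u
      · subst hj
        simp [hN', hN, weightedLaplacian, hl, Fintype.sum_option]
        ring
      · simp [hN', hN, weightedLaplacian, hl, hj]
    · simp [hN', hN, weightedLaplacian, hl, Fintype.sum_option]
      ring
  have h3 : N'.det = M.det * (P none + B none) := by
    rw [← Matrix.det_submatrix_equiv_self (Equiv.optionEquivSumPUnit.{0} V).symm, h2,
      Matrix.det_fromBlocks_zero₂₁]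
    simp
  rw [h1, mul_comm] at h3
  exact mul_right_cancel₀ h0 h3

theorem det_weightedLaplacian_comp_equiv {W : Type*} [Fintype W] [DecidableEq W] (f : W ≃ V)
    (A : V → V → R) (P B : V → R) :
    (weightedLaplacian (fun i j => A (f i) (f j)) (P ∘ f) (B ∘ f)).det =
      (weightedLaplacian A P B).det := by
  rw [← Matrix.det_submatrix_equiv_self f]
  congr 1
  ext i j
  simp [weightedLaplacian, f.sum_comp (fun k => A (f i) k)]

theorem det_weightedLaplacian_unique [Unique V] (A : V → V → R) (P B : V → R) :
    (weightedLaplacian A P B).det = P default := by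
  simp [weightedLaplacian]

end WeightedLaplacian

/-! ### The Laplacian polynomials of trees -/

open Classical in
/-- The adjacency matrix of a graph, with polynomial entries. -/
noncomputable def edgeIndicator {V : Type*} (G : SimpleGraph V) (i j : V) : ℝ[X] :=
  if G.Adj i j then 1 else 0

/-- Among the trees with a given number of vertices, the path has the largest Laplacian
coefficients. The weighted form, in which a pair with `s i` vertices hangs on each vertex `i`,
allows the induction to remove leaves. -/
theorem det_weightedLaplacian_tree (n : ℕ) : ∀ {V : Type} [Fintype V] [DecidableEq V]
    (G : SimpleGraph V), G.IsTree → Fintype.card V = n → ∀ (P B : V → ℝ[X]) (s : V → ℕ),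
    (∀ i, PathBounded (P i) (B i) (s i)) →
    CoeffLE X (weightedLaplacian (edgeIndicator G) P B).det ∧
      CoeffLE (weightedLaplacian (edgeIndicator G) P B).det (X * (pathPair (∑ i, s i)).1) := by
  induction n with
  | zero =>
    intro V _ _ G hG hn
    have := hG.connected.nonempty
    exact absurd hn Fintype.card_ne_zero
  | succ n ih =>
    intro V _ _ G hG hn P B s h
    have := hG.connected.nonempty
    rcases subsingleton_or_nontrivial V with hV | hV
    · obtain ⟨x⟩ := this
      let _ : Unique V := ⟨⟨x⟩, fun y => Subsingleton.elim _ _⟩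
      rw [det_weightedLaplacian_unique, Fintype.sum_unique]
      exact ⟨(h _).X_le, (h _).le_fst⟩
    · classical
      obtain ⟨m, hm⟩ := hG.exists_vert_degree_one_of_nontrivial
      have hconn := hG.connected.induce_compl_singleton_of_degree_eq_one hm
      obtain ⟨u, hmu, hu⟩ := SimpleGraph.degree_eq_one_iff_existsUnique_adj.mp hm
      have hum : u ≠ m := hmu.ne'
      have hl : ∀ a : {x // x ≠ m}, G.Adj m a ↔ a = ⟨u, hum⟩ := fun a =>
        ⟨fun ha => Subtype.ext (hu _ ha), fun ha => by rw [ha]; exact hmu⟩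
      let f := Equiv.optionSubtypeNe m
      set G' : SimpleGraph {x // x ≠ m} := G.comap Subtype.val with hG'
      have htree : G'.IsTree := ⟨hconn, hG.isAcyclic.comap
        (⟨Subtype.val, fun h => h⟩ : G' →g G) Subtype.val_injective⟩
      have hcard : Fintype.card {x // x ≠ m} = n := by
        have := Fintype.card_congr f
        rw [Fintype.card_option] at this
        lia
      have hs : ∀ i, PathBounded ((P ∘ f) i) ((B ∘ f) i) ((s ∘ f) i) := fun i => h (f i)
      rw [← det_weightedLaplacian_comp_equiv f,
        det_weightedLaplacian_option (edgeIndicator G') _ ⟨u, hum⟩ ?_ ?_ ?_ _ _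
          (hs none).add_ne_zero]
      · have hsum : ∑ i, s i = ∑ i, Function.update (fun i => (s ∘ f) (some i)) ⟨u, hum⟩
            ((s ∘ f) (some ⟨u, hum⟩) + (s ∘ f) none) i := by
          rw [← f.sum_comp s, Fintype.sum_option, Finset.sum_update_of_mem (Finset.mem_univ _),
            ← Finset.add_sum_erase Finset.univ (fun i => s (f (some i))) (Finset.mem_univ ⟨u, hum⟩),
            Finset.sdiff_singleton_eq_erase]
          simp only [Function.comp_apply]
          ring
        rw [hsum]
        refine ih G' htree hcard _ _ _ fun i => ?_
        by_cases hi : i = ⟨u, hum⟩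
        · subst hi
          simpa using (hs (some ⟨u, hum⟩)).join (hs none)
        · simpa [hi] using hs (some i)
      · intro a b; simp [f, edgeIndicator, hG']
      · intro a
        simp [f, edgeIndicator, hl]
      · intro a
        simp [f, edgeIndicator, hl, G.adj_comm _ m]

/-- The path attains the bound of `det_weightedLaplacian_tree`, even if a further path with `k`
vertices replaces its last vertex. -/
theorem det_weightedLaplacian_path (n : ℕ) : ∀ k,
    (weightedLaplacian (edgeIndicator (SimpleGraph.pathGraph (n + 1)))
      (fun i => X * (pathPair (if i = Fin.last n then k else 1)).1)
      (fun i => (pathPair (if i = Fin.last n then k else 1)).2)).det =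
      X * (pathPair (n + k)).1 := by
  induction n with
  | zero =>
    intro k
    refine (Matrix.det_fin_one _).trans ?_
    simp [weightedLaplacian]
  | succ n ih =>
    intro k
    have h0 : X * (pathPair k).1 + (pathPair k).2 ≠ 0 := by
      rw [← pathPair_snd_succ]
      intro h
      have h1 := one_le_pathPair_snd (k + 1) 0
      rw [h] at h1
      norm_num at h1
    have key := det_weightedLaplacian_option (R := ℝ[X])
      (edgeIndicator (SimpleGraph.pathGraph (n + 1)))
      (fun i j => edgeIndicator (SimpleGraph.pathGraph (n + 2)) (finSuccEquivLast.symm i)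
        (finSuccEquivLast.symm j)) (Fin.last n) ?_ ?_ ?_
      ((fun i => X * (pathPair (if i = Fin.last (n + 1) then k else 1)).1) ∘ finSuccEquivLast.symm)
      ((fun i => (pathPair (if i = Fin.last (n + 1) then k else 1)).2) ∘ finSuccEquivLast.symm)
      (by simpa using h0)
    · rw [det_weightedLaplacian_comp_equiv] at key
      rw [show n + 1 + k = n + (k + 1) by lia]
      refine key.trans (Eq.trans ?_ (ih (k + 1)))
      congr 2
      · ext1 i
        by_cases hi : i = Fin.last n
        · subst hi
          simp [pathPair_one, pathPair_fst_succ, (Fin.castSucc_lt_last (Fin.last n)).ne]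
          ring
        · simp [hi]
      · ext1 i
        by_cases hi : i = Fin.last n
        · subst hi
          simp [pathPair_one, pathPair_snd_succ, (Fin.castSucc_lt_last (Fin.last n)).ne]
        · simp [hi]
    · intro a b
      simp [edgeIndicator, SimpleGraph.pathGraph_adj]
    · intro a
      have : n + 1 + 1 ≠ a := by lia
      simp [edgeIndicator, SimpleGraph.pathGraph_adj, this, Fin.ext_iff]
    · intro a
      have : n + 1 + 1 ≠ a := by lia
      simp [edgeIndicator, SimpleGraph.pathGraph_adj, this, Fin.ext_iff]

/-! ### Sums of reciprocals of shifted roots -/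

theorem pos_of_one_le_prod {s : Multiset ℝ}
    (h : CoeffLE 1 (s.map fun μ => X + C μ).prod) {μ : ℝ} (hμ : μ ∈ s) : 0 < μ := by
  by_contra! h0
  have h1 := h.eval_le (neg_nonneg.2 h0)
  have h2 : eval (-μ) (s.map fun μ => X + C μ).prod = 0 := by
    rw [eval_multiset_prod, Multiset.prod_eq_zero_iff, Multiset.map_map, Multiset.mem_map]
    exact ⟨μ, hμ, by simp⟩
  rw [h2, eval_one] at h1
  linarith

theorem natDegree_multiset_prod_X_add_C (s : Multiset ℝ) :
    natDegree (s.map fun μ => X + C μ).prod = Multiset.card s := by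
  rw [natDegree_multiset_prod_of_monic _ fun f hf => ?_]
  · simp
  · obtain ⟨μ, -, rfl⟩ := Multiset.mem_map.1 hf
    exact monic_X_add_C μ

theorem eval_derivative_prod_X_add_C (s : Multiset ℝ) (t : ℝ) (h : ∀ μ ∈ s, μ + t ≠ 0) :
    eval t (derivative (s.map fun μ => X + C μ).prod) =
      eval t (s.map fun μ => X + C μ).prod * (s.map fun μ => (μ + t)⁻¹).sum := by
  induction s using Multiset.induction with
  | empty => simp
  | cons a s ih =>
    have ha : a + t ≠ 0 := h a (Multiset.mem_cons_self _ _)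
    simp only [Multiset.map_cons, Multiset.prod_cons, Multiset.sum_cons, derivative_mul, eval_add,
      eval_mul, ih fun μ hμ => h μ (Multiset.mem_cons_of_mem hμ), derivative_X, derivative_C,
      eval_X, eval_C, eval_one, eval_zero, derivative_add]
    field_simp
    ring

theorem eval_X_mul_derivative_le {p : ℝ[X]} (hp : CoeffLE 0 p) {m t : ℝ} (ht : 0 ≤ t)
    (hm : ∀ i : ℕ, m < i → p.coeff i = 0) : t * eval t (derivative p) ≤ m * eval t p := by
  have h : CoeffLE (X * derivative p) (C m * p) := by
    intro i
    have hi : (X * derivative p).coeff i = i * p.coeff i := by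
      cases i with
      | zero => simp
      | succ i => rw [coeff_X_mul, coeff_derivative]; push_cast; ring
    rw [hi, coeff_C_mul]
    rcases lt_or_ge m i with h | h
    · simp [hm i h]
    · exact mul_le_mul_of_nonneg_right h (by simpa using hp i)
  simpa using h.eval_le ht

/-- If the elementary symmetric polynomials of `s'` dominate those of `s` and the sums agree and are
`2 n`, then for `t ≥ n` the sum of the reciprocals of the roots shifted by `t` is smaller for
`s'`. With `p` and `q = p + δ` the two polynomials, the sums are the logarithmic derivatives at
`t`, and `t δ'(t) ≤ (n - 2) δ(t)` because `δ` has degree at most `n - 2`, whereas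
`t p'(t) ≥ (n - 2) p(t)`. -/
theorem sum_inv_add_le {s s' : Multiset ℝ} {n : ℕ} (hs : Multiset.card s = n)
    (hs' : Multiset.card s' = n) (hsum : s.sum = 2 * n) (hsum' : s'.sum = 2 * n)
    (h1 : CoeffLE 1 (s.map fun μ => X + C μ).prod)
    (hle : CoeffLE (s.map fun μ => X + C μ).prod (s'.map fun μ => X + C μ).prod)
    {t : ℝ} (ht0 : 0 < t) (ht : n ≤ t) :
    (s'.map fun μ => (μ + t)⁻¹).sum ≤ (s.map fun μ => (μ + t)⁻¹).sum := by
  have hpos := fun μ (hμ : μ ∈ s) => pos_of_one_le_prod h1 hμ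
  have hpos' := fun μ (hμ : μ ∈ s') => pos_of_one_le_prod (h1.trans hle) hμ
  have hd := eval_derivative_prod_X_add_C s t fun μ hμ => (add_pos (hpos μ hμ) ht0).ne'
  have hd' := eval_derivative_prod_X_add_C s' t fun μ hμ => (add_pos (hpos' μ hμ) ht0).ne'
  have hS : (n : ℝ) - 2 ≤ t * (s.map fun μ => (μ + t)⁻¹).sum := by
    have h2 : (s.map fun μ => 1 - μ / t).sum ≤ (s.map fun μ => t * (μ + t)⁻¹).sum := by
      refine Multiset.sum_map_le_sum_map _ _ fun μ hμ => ?_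
      have hμ := hpos μ hμ
      rw [← div_eq_mul_inv, le_div_iff₀ (by positivity)]
      have : (1 - μ / t) * (μ + t) = t - μ ^ 2 / t := by field_simp; ring
      rw [this]
      have : 0 ≤ μ ^ 2 / t := by positivity
      linarith
    rw [Multiset.sum_map_mul_left] at h2
    have h3 : (s.map fun μ => 1 - μ / t).sum = n - 2 * n / t := by
      rw [Multiset.sum_map_sub, Multiset.sum_map_div]
      simp [hs, hsum]
    have h4 : 2 * (n : ℝ) / t ≤ 2 := by
      rw [div_le_iff₀ ht0]; linarith
    linarith
  set p := (s.map fun μ => X + C μ).prod with hp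
  set q := (s'.map fun μ => X + C μ).prod with hq
  set S := (s.map fun μ => (μ + t)⁻¹).sum
  set S' := (s'.map fun μ => (μ + t)⁻¹).sum
  have hδ : ∀ i : ℕ, (n : ℝ) - 2 < i → (q - p).coeff i = 0 := by
    intro i hi
    have hi : n < i + 2 := by
      have : (n : ℝ) < i + 2 := by linarith
      exact_mod_cast this
    rw [coeff_sub]
    rcases lt_or_ge n i with h | h
    · rw [coeff_eq_zero_of_natDegree_lt, coeff_eq_zero_of_natDegree_lt, sub_zero]
      · rwa [hp, natDegree_multiset_prod_X_add_C, hs]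
      · rwa [hq, natDegree_multiset_prod_X_add_C, hs']
    · rw [hp, hq, Multiset.prod_X_add_C_coeff _ (by lia), Multiset.prod_X_add_C_coeff _ (by lia),
        hs, hs']
      have : n - i = 0 ∨ n - i = 1 := by lia
      rcases this with h | h <;> simp [h, Multiset.esymm, Multiset.powersetCard_one, hsum, hsum']
  have hδ' := eval_X_mul_derivative_le hle.sub_nonneg ht0.le hδ
  have hδ0 := hle.sub_nonneg.eval_nonneg ht0.le
  have hq0 : 1 ≤ eval t q := by simpa using (h1.trans hle).eval_le ht0.le
  rw [derivative_sub, eval_sub, eval_sub, hd, hd'] at hδ'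
  rw [eval_sub] at hδ0
  have h5 : t * (eval t q * S') ≤ t * (eval t q * S) := by
    nlinarith [mul_le_mul_of_nonneg_right hS hδ0]
  exact le_of_mul_le_mul_left (le_of_mul_le_mul_left h5 ht0) (by linarith)

/-! ### Non-trivial eigenvalues -/

section Eigenvalues

variable {v : ℕ} {L : Matrix (Fin v) (Fin v) ℝ}

theorem charpoly_eq_X_mul_prod [NeZero v] (hL : L.IsHermitian) (h1 : L *ᵥ (fun _ => 1) = 0) :
    L.charpoly = X * ((nontrivialEigenvalues L).map fun μ => X - C μ).prod := by
  have h0 : (0 : ℝ) ∈ L.charpoly.roots := by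
    rw [mem_roots L.charpoly_monic.ne_zero, IsRoot, ← coeff_zero_eq_eval_zero]
    have hdet : L.det = 0 :=
      Matrix.exists_mulVec_eq_zero_iff.1 ⟨_, fun h => one_ne_zero (congrFun h 0), h1⟩
    rw [Matrix.det_eq_sign_charpoly_coeff] at hdet
    simpa using hdet
  conv_lhs => rw [hL.splits_charpoly.eq_prod_roots_of_monic L.charpoly_monic,
    ← Multiset.cons_erase h0, Multiset.map_cons, Multiset.prod_cons]
  simp [nontrivialEigenvalues]

theorem card_nontrivialEigenvalues_add_one [NeZero v] (hL : L.IsHermitian)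
    (h1 : L *ᵥ (fun _ => 1) = 0) : Multiset.card (nontrivialEigenvalues L) + 1 = v := by
  have h := congrArg natDegree (charpoly_eq_X_mul_prod hL h1)
  rw [L.charpoly_natDegree_eq_dim, natDegree_mul X_ne_zero
    (monic_multiset_prod_of_monic _ _ fun _ _ => monic_X_sub_C _).ne_zero, natDegree_X,
    natDegree_multiset_prod_X_sub_C_eq_card, Fintype.card_fin] at h
  lia

theorem sum_nontrivialEigenvalues (hL : L.IsHermitian) :
    (nontrivialEigenvalues L).sum = L.trace := by
  rw [Matrix.trace_eq_sum_roots_charpoly_of_splits hL.splits_charpoly, nontrivialEigenvalues]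
  by_cases h : (0 : ℝ) ∈ L.charpoly.roots
  · conv_rhs => rw [← Multiset.cons_erase h, Multiset.sum_cons, zero_add]
  · rw [Multiset.erase_of_notMem h]

theorem charpoly_neg_eq_X_mul_prod [NeZero v] (hL : L.IsHermitian)
    (h1 : L *ᵥ (fun _ => 1) = 0) :
    (-L).charpoly = X * ((nontrivialEigenvalues L).map fun μ => X + C μ).prod := by
  refine Polynomial.funext fun z => ?_
  have h2 := congrArg (eval (-z)) (charpoly_eq_X_mul_prod hL h1)
  have h3 : Matrix.scalar (Fin v) z - -L = -(Matrix.scalar (Fin v) (-z) - L) := by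
    rw [map_neg]; abel
  rw [Matrix.eval_charpoly, h3, Matrix.det_neg, ← Matrix.eval_charpoly, h2, Fintype.card_fin,
    congrArg ((-1 : ℝ) ^ ·) (card_nontrivialEigenvalues_add_one hL h1).symm]
  generalize nontrivialEigenvalues L = s
  simp only [eval_mul, eval_X, eval_multiset_prod, Multiset.map_map, Function.comp_def, eval_sub,
    eval_add, eval_C]
  have h4 : (s.map fun μ => -z - μ).prod = (-1) ^ Multiset.card s * (s.map fun μ => z + μ).prod := by
    have := Multiset.prod_map_neg (s.map fun μ => z + μ)
    simpa only [Multiset.map_map, Multiset.card_map, Function.comp_def, neg_add'] using this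
  rw [h4, pow_succ]
  have h5 : ((-1 : ℝ) ^ Multiset.card s) * (-1) ^ Multiset.card s = 1 := by
    rw [← mul_pow]; simp
  linear_combination (z * (s.map fun μ => z + μ).prod) * h5

/-- On the orthogonal complement of the all-one vector, `v I - J` acts as the scalar `v`, so adding
a multiple of it to `L` shifts the non-trivial eigenvalues. -/
theorem nontrivialEigenvalues_half_add [NeZero v] (hL : L.IsHermitian)
    (h1 : L *ᵥ (fun _ => 1) = 0) (c : ℝ) :
    nontrivialEigenvalues ((1 / 2 : ℝ) •
        (L + c • ((v : ℝ) • (1 : Matrix (Fin v) (Fin v) ℝ) - Matrix.of fun _ _ => 1))) =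
      (nontrivialEigenvalues L).map fun μ => (μ + c * v) / 2 := by
  set M := (1 / 2 : ℝ) •
    (L + c • ((v : ℝ) • (1 : Matrix (Fin v) (Fin v) ℝ) - Matrix.of fun _ _ => 1)) with hM
  set s := nontrivialEigenvalues L with hs
  have hchar : M.charpoly = X * ((s.map fun μ => (μ + c * v) / 2).map fun μ => X - C μ).prod := by
    -- The factorization below divides by `2 z - c v`, so the point `z = c v / 2` is left out.
    refine eq_of_infinite_eval_eq _ _ (Set.Infinite.mono (s := {c * v / 2}ᶜ) ?_
      (Set.finite_singleton _).infinite_compl)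
    intro z hz
    have hz' : 2 * z - c * v ≠ 0 := fun h => hz (by rw [Set.mem_singleton_iff]; linarith)
    set z' := 2 * z - c * v with hz'def
    have hLJ : L * (Matrix.of fun _ _ : Fin v => (1 : ℝ)) = 0 := by
      ext i j
      simpa [Matrix.mul_apply, Matrix.mulVec, dotProduct] using congrFun h1 i
    have hfac : Matrix.scalar (Fin v) z - M = (1 / 2 : ℝ) • ((Matrix.scalar (Fin v) z' - L) *
        (1 + (c / z') • Matrix.of fun _ _ : Fin v => (1 : ℝ))) := by
      rw [mul_add, mul_one, mul_smul_comm, sub_mul, hLJ, sub_zero]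
      ext i j
      by_cases h : i = j
      · subst h
        simp [hM]
        field_simp
        rw [hz'def]
        ring
      · simp [hM, h]
        field_simp
        ring
    have hdetJ : (1 + (c / z') • Matrix.of fun _ _ : Fin v => (1 : ℝ)).det = 1 + c * v / z' := by
      have : (c / z') • (Matrix.of fun _ _ : Fin v => (1 : ℝ)) =
          Matrix.replicateCol Unit (fun _ : Fin v => c / z') *
            Matrix.replicateRow Unit (fun _ : Fin v => (1 : ℝ)) := by
        ext i j; simp [Matrix.mul_apply]
      rw [this, Matrix.det_one_add_replicateCol_mul_replicateRow]
      simp [dotProduct]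
      ring
    change eval z M.charpoly = _
    rw [Matrix.eval_charpoly, hfac, Matrix.det_smul, Matrix.det_mul, ← Matrix.eval_charpoly, hdetJ,
      charpoly_eq_X_mul_prod hL h1, ← hs, Fintype.card_fin]
    have hcard := card_nontrivialEigenvalues_add_one hL h1
    rw [← hs] at hcard
    conv_lhs => rw [← hcard, pow_succ]
    simp only [eval_mul, eval_X, eval_multiset_prod, Multiset.map_map, Function.comp_def, eval_sub,
      eval_C]
    have h4 : (s.map fun μ => z - (μ + c * v) / 2).prod =
        (1 / 2) ^ Multiset.card s * (s.map fun μ => z' - μ).prod := by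
      rw [← Multiset.prod_replicate, ← Multiset.map_const', ← Multiset.prod_map_mul]
      congr 1
      refine Multiset.map_congr rfl fun μ _ => ?_
      rw [hz'def]; ring
    rw [h4]
    field_simp
    rw [hcard, hz'def]
    ring
  rw [nontrivialEigenvalues, hchar, roots_mul, roots_X, roots_multiset_prod_X_sub_C]
  · simp
  · exact mul_ne_zero X_ne_zero
      (monic_multiset_prod_of_monic _ _ fun _ _ => monic_X_sub_C _).ne_zero

end Eigenvalues

/-! ### Laplacian spectra of trees and paths -/

section Graphs

variable {v : ℕ}

theorem charpoly_neg_lapMatrix (G : SimpleGraph (Fin v)) [DecidableRel G.Adj] :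
    (-(G.lapMatrix ℝ)).charpoly =
      (weightedLaplacian (edgeIndicator G) (fun _ => X) (fun _ => 1)).det := by
  rw [Matrix.charpoly]
  congr 1
  ext1 i j
  by_cases h : i = j
  · subst h
    have hdeg : C (G.degree i : ℝ) = ∑ k, edgeIndicator G i k := by
      rw [SimpleGraph.degree_eq_sum_if_adj, map_sum]
      exact Finset.sum_congr rfl fun k _ => by simp [edgeIndicator, apply_ite C]
    rw [weightedLaplacian, Matrix.of_apply, ← hdeg]
    simp [SimpleGraph.lapMatrix, SimpleGraph.degMatrix, edgeIndicator]
  · simp [weightedLaplacian, SimpleGraph.lapMatrix, SimpleGraph.degMatrix,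
      edgeIndicator, h, SimpleGraph.adjMatrix_apply, apply_ite C]

theorem prod_X_add_eigenvalues_tree [NeZero v] {G : SimpleGraph (Fin v)} [DecidableRel G.Adj]
    (hG : G.IsTree) :
    CoeffLE 1 ((nontrivialEigenvalues (G.lapMatrix ℝ)).map fun μ => X + C μ).prod ∧
      CoeffLE ((nontrivialEigenvalues (G.lapMatrix ℝ)).map fun μ => X + C μ).prod
        (pathPair v).1 := by
  have h := det_weightedLaplacian_tree _ G hG rfl _ _ _ fun _ => PathBounded.single
  rw [← charpoly_neg_lapMatrix, charpoly_neg_eq_X_mul_prod (G.isHermitian_lapMatrix ℝ)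
    G.lapMatrix_mulVec_const_eq_zero] at h
  refine ⟨fun i => ?_, fun i => ?_⟩
  · have := h.1 (i + 1)
    rw [coeff_X_mul] at this
    rwa [← coeff_X_mul, mul_one]
  · have := h.2 (i + 1)
    rw [coeff_X_mul, coeff_X_mul] at this
    simpa using this

theorem isHermitian_pathLaplacian (w : Equiv.Perm (Fin v)) : (pathLaplacian w).IsHermitian := by
  classical exact SimpleGraph.isHermitian_lapMatrix ℝ _

theorem pathLaplacian_mulVec_one (w : Equiv.Perm (Fin v)) :
    pathLaplacian w *ᵥ (fun _ => 1) = 0 := by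
  classical exact SimpleGraph.lapMatrix_mulVec_const_eq_zero _

theorem prod_X_add_eigenvalues_path [NeZero v] (w : Equiv.Perm (Fin v)) :
    ((nontrivialEigenvalues (pathLaplacian w)).map fun μ => X + C μ).prod = (pathPair v).1 := by
  have h : (-(pathLaplacian w)).charpoly = (weightedLaplacian (edgeIndicator
      ((SimpleGraph.pathGraph v).map w.toEmbedding)) (fun _ => X) (fun _ => 1)).det := by
    classical exact charpoly_neg_lapMatrix _
  rw [charpoly_neg_eq_X_mul_prod (isHermitian_pathLaplacian w) (pathLaplacian_mulVec_one w),
    ← det_weightedLaplacian_comp_equiv w] at h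
  have hw : (fun i j => edgeIndicator ((SimpleGraph.pathGraph v).map w.toEmbedding) (w i) (w j)) =
      edgeIndicator (SimpleGraph.pathGraph v) := by
    ext1 i; ext1 j
    have : ((SimpleGraph.pathGraph v).map w.toEmbedding).Adj (w i) (w j) ↔
        (SimpleGraph.pathGraph v).Adj i j :=
      SimpleGraph.map_adj_apply (f := w.toEmbedding)
    unfold edgeIndicator
    by_cases hij : (SimpleGraph.pathGraph v).Adj i j
    · rw [if_pos hij, if_pos (this.2 hij)]
    · rw [if_neg hij, if_neg (mt this.1 hij)]
  rw [hw] at h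
  obtain ⟨n, rfl⟩ := Nat.exists_eq_succ_of_ne_zero (NeZero.ne v)
  have h2 := det_weightedLaplacian_path n 1
  simp only [ite_self, pathPair_one, mul_one] at h2
  exact mul_left_cancel₀ X_ne_zero (h.trans h2)

end Graphs

/-! ### Designs with block size two as multigraphs -/

namespace Matrix

/-- A matrix with zero row sums is determined by its off-diagonal entries. -/
theorem ext_of_mulVec_one_eq_zero {n : Type*} [Fintype n] [DecidableEq n] {A B : Matrix n n ℝ}
    (hA : A *ᵥ (fun _ => 1) = 0) (hB : B *ᵥ (fun _ => 1) = 0)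
    (h : ∀ i j, i ≠ j → A i j = B i j) : A = B := by
  ext i j
  by_cases hij : i = j
  · subst hij
    have h1 := congrFun hA i
    have h2 := congrFun hB i
    simp only [mulVec, dotProduct, mul_one, Pi.zero_apply] at h1 h2
    rw [← Finset.add_sum_erase _ _ (Finset.mem_univ i)] at h1 h2
    have h3 : ∑ k ∈ Finset.univ.erase i, A i k = ∑ k ∈ Finset.univ.erase i, B i k :=
      Finset.sum_congr rfl fun k hk => h i k (Finset.ne_of_mem_erase hk).symm
    linarith
  · exact h i j hij

end Matrix

namespace BinaryDesign

variable {v : ℕ} (d : BinaryDesign v 2)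

theorem concurrence_apply (i j : Fin v) :
    d.concurrence i j =
      ((Finset.univ.filter fun l => i ∈ d.block l ∧ j ∈ d.block l).card : ℝ) := by
  simp [concurrence, incidence, Matrix.mul_apply, ← ite_and, and_comm]

theorem laplacian_apply_of_ne {i j : Fin v} (h : i ≠ j) :
    d.laplacian i j =
      -((Finset.univ.filter fun l => i ∈ d.block l ∧ j ∈ d.block l).card : ℝ) := by
  simp [laplacian, h, concurrence_apply]

theorem laplacian_apply_self (i : Fin v) : d.laplacian i i = d.replication i := by
  simp [laplacian, concurrence_apply, replication]
  ring

theorem isHermitian_laplacian : d.laplacian.IsHermitian := by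
  ext i j
  by_cases h : i = j
  · subst h; simp
  · simp [laplacian_apply_of_ne _ h, laplacian_apply_of_ne _ (Ne.symm h), and_comm]

theorem sum_concurrence (i : Fin v) : ∑ j, d.concurrence i j = 2 * d.replication i := by
  have h : ∀ j, d.concurrence i j =
      ∑ l ∈ Finset.univ.filter (fun l => i ∈ d.block l), if j ∈ d.block l then 1 else 0 := by
    intro j
    rw [concurrence_apply, ← Finset.filter_filter, Finset.card_filter]
    push_cast
    rfl
  simp_rw [h]
  rw [Finset.sum_comm]
  simp [d.card_block, replication, mul_comm]

theorem laplacian_mulVec_one : d.laplacian *ᵥ (fun _ => 1) = 0 := by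
  ext i
  have h := d.sum_concurrence i
  simp [laplacian, Matrix.mulVec, dotProduct, Finset.sum_sub_distrib, h, Matrix.diagonal_apply]

theorem trace_laplacian : d.laplacian.trace = 2 * d.numBlocks := by
  have h : ∀ i, (d.replication i : ℝ) = ∑ l, if i ∈ d.block l then 1 else 0 := by
    intro i; simp [replication]
  simp_rw [Matrix.trace, Matrix.diag, laplacian_apply_self, h]
  rw [Finset.sum_comm]
  simp [d.card_block, mul_comm]

theorem informationMatrix_eq : d.informationMatrix = (1 / 2 : ℝ) • d.laplacian := by
  ext i j
  simp [informationMatrix, laplacian]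
  ring

theorem IsBIBD.laplacian_eq {d : BinaryDesign v 2} {lam : ℕ} (h : d.IsBIBD lam) :
    d.laplacian =
      (lam : ℝ) • ((v : ℝ) • (1 : Matrix (Fin v) (Fin v) ℝ) - Matrix.of fun _ _ => 1) := by
  refine Matrix.ext_of_mulVec_one_eq_zero d.laplacian_mulVec_one ?_ fun i j hij => ?_
  · ext i
    simp [Matrix.mulVec, dotProduct, Matrix.one_apply, ← Finset.mul_sum]
  · have := h.concurrence_eq i j hij
    rw [concurrence_apply] at this
    simp [laplacian_apply_of_ne _ hij, this, hij]

/-- The simple graph underlying the concurrence graph of a design. -/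
def graph : SimpleGraph (Fin v) where
  Adj i j := i ≠ j ∧ ∃ l, i ∈ d.block l ∧ j ∈ d.block l
  symm := ⟨fun _ _ h => ⟨h.1.symm, h.2.imp fun _ h => h.symm⟩⟩
  loopless := ⟨fun _ h => h.1 rfl⟩

theorem graph_adj_iff {i j : Fin v} (h : i ≠ j) : d.graph.Adj i j ↔ d.laplacian i j ≠ 0 := by
  rw [laplacian_apply_of_ne _ h, neg_ne_zero, Nat.cast_ne_zero, Finset.card_ne_zero,
    Finset.filter_nonempty_iff]
  simp [graph, h]

theorem block_eq {i j : Fin v} {l : Fin d.numBlocks} (h : i ≠ j) (hi : i ∈ d.block l)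
    (hj : j ∈ d.block l) : d.block l = {i, j} := by
  refine (Finset.eq_of_subset_of_card_le ?_ ?_).symm
  · simp [Finset.insert_subset_iff, hi, hj]
  · rw [d.card_block, Finset.card_pair h]

theorem DifferenceEstimable.refl (p : Fin v) : d.DifferenceEstimable p p :=
  ⟨0, fun τ β => by simp⟩

variable {d}

theorem DifferenceEstimable.trans {p q r : Fin v} (h : d.DifferenceEstimable p q)
    (h' : d.DifferenceEstimable q r) : d.DifferenceEstimable p r := by
  obtain ⟨a, ha⟩ := h
  obtain ⟨b, hb⟩ := h'
  refine ⟨a + b, fun τ β => ?_⟩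
  simp only [Pi.add_apply, add_mul, Finset.sum_add_distrib, ha, hb]
  ring

theorem DifferenceEstimable.of_adj {p q : Fin v} (h : d.graph.Adj p q) :
    d.DifferenceEstimable p q := by
  obtain ⟨hne, l, hp, hq⟩ := h
  refine ⟨fun j i => if j = l then (if i = p then 1 else -1) else 0, fun τ β => ?_⟩
  rw [Finset.sum_eq_single l]
  · rw [d.block_eq hne hp hq, Finset.sum_pair hne]
    simp [hne.symm, sub_eq_add_neg]
  · intro j _ hj
    simp [hj]
  · simp

/-- Taking the indicator of a connected component for `τ`, and cancelling it by `β`, shows that the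
difference of treatments in different components is not estimable. -/
theorem DifferenceEstimable.reachable {p q : Fin v} (h : d.DifferenceEstimable p q) :
    d.graph.Reachable p q := by
  classical
  obtain ⟨a, ha⟩ := h
  by_contra hpq
  let τ : Fin v → ℝ := fun i => if d.graph.Reachable p i then 1 else 0
  have hblock : ∀ l, ∃ b : ℝ, ∀ i ∈ d.block l, τ i + b = 0 := by
    intro l
    obtain ⟨x, y, hxy, hl⟩ := Finset.card_eq_two.1 (d.card_block l)
    have hadj : d.graph.Adj x y := ⟨hxy, l, by simp [hl], by simp [hl]⟩
    have hτ : τ y = τ x := by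
      have : d.graph.Reachable p y ↔ d.graph.Reachable p x :=
        ⟨fun h => h.trans hadj.symm.reachable, fun h => h.trans hadj.reachable⟩
      simp [τ, this]
    refine ⟨-τ x, fun i hi => ?_⟩
    rw [hl, Finset.mem_insert, Finset.mem_singleton] at hi
    rcases hi with rfl | rfl
    · ring
    · rw [hτ]; ring
  choose β hβ using hblock
  have h1 := ha τ β
  rw [Finset.sum_eq_zero fun l _ => Finset.sum_eq_zero fun i hi => by rw [hβ l i hi, mul_zero]] at h1
  simp [τ, hpq] at h1

variable (d)

theorem connected_iff [NeZero v] : d.Connected ↔ d.graph.Connected := by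
  refine ⟨fun h => ?_, fun h p q => ?_⟩
  · have : Nonempty (Fin v) := ⟨0⟩
    exact ⟨fun p q => (h p q).reachable⟩
  · obtain ⟨W⟩ := h.preconnected p q
    induction W with
    | nil => exact .refl d _
    | cons hadj _ ih => exact (DifferenceEstimable.of_adj hadj).trans ih

variable {d}

/-- A connected design with `v - 1` blocks is a tree, whose edges are the blocks. Indeed a connected
graph has at least `v - 1` edges, so that the blocks are distinct. -/
theorem isTree_graph [NeZero v] (hd : d.Connected) (hb : d.numBlocks = v - 1) :
    d.graph.IsTree ∧
      ∀ [DecidableRel d.graph.Adj], d.laplacian = d.graph.lapMatrix ℝ := by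
  have hconn := d.connected_iff.1 hd
  have hv : 0 < v := Nat.pos_of_ne_zero (NeZero.ne v)
  have hex : ∀ x : d.graph.edgeSet, ∃ l, ∀ i, i ∈ x.1 ↔ i ∈ d.block l := by
    rintro ⟨x, hx⟩
    induction x using Sym2.ind with
    | h i j =>
      have ⟨hne, l, hi, hj⟩ := (SimpleGraph.mem_edgeSet _).1 hx
      exact ⟨l, fun k => by simp [d.block_eq hne hi hj]⟩
  choose φ hφ using hex
  have hinj : Function.Injective φ := fun x y hxy => by
    refine Subtype.ext (Sym2.ext fun i => ?_)
    rw [hφ, hφ, hxy]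
  have hle : Nat.card d.graph.edgeSet ≤ v - 1 := by
    have := Nat.card_le_card_of_injective φ hinj
    rwa [Nat.card_fin, hb] at this
  have hge := hconn.card_vert_le_card_edgeSet_add_one
  rw [Nat.card_fin] at hge
  have hcard : Nat.card d.graph.edgeSet + 1 = v := by lia
  refine ⟨SimpleGraph.isTree_iff_connected_and_card.2 ⟨hconn, by rwa [Nat.card_fin]⟩, ?_⟩
  have hsurj : Function.Surjective φ :=
    ((Nat.bijective_iff_injective_and_card φ).2 ⟨hinj, by rw [Nat.card_fin]; lia⟩).2
  intro _
  refine Matrix.ext_of_mulVec_one_eq_zero d.laplacian_mulVec_one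
    d.graph.lapMatrix_mulVec_const_eq_zero fun i j hij => ?_
  rw [laplacian_apply_of_ne _ hij]
  have huniq : (Finset.univ.filter fun l => i ∈ d.block l ∧ j ∈ d.block l).card =
      if d.graph.Adj i j then 1 else 0 := by
    split_ifs with h
    · obtain ⟨-, l, hi, hj⟩ := h
      rw [Finset.card_eq_one]
      refine ⟨l, Finset.eq_singleton_iff_unique_mem.2 ⟨by simp [hi, hj], fun l' hl' => ?_⟩⟩
      obtain ⟨hi', hj'⟩ := (Finset.mem_filter.1 hl').2
      obtain ⟨x, rfl⟩ := hsurj l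
      obtain ⟨y, rfl⟩ := hsurj l'
      rw [← hφ] at hi hj hi' hj'
      have hx := (Sym2.mem_and_mem_iff hij).1 ⟨hi, hj⟩
      have hy := (Sym2.mem_and_mem_iff hij).1 ⟨hi', hj'⟩
      rw [Subtype.ext (hy.trans hx.symm)]
    · rw [Finset.card_eq_zero, Finset.filter_eq_empty_iff]
      exact fun l _ hl => h ⟨hij, l, hl⟩
  simp [huniq, SimpleGraph.lapMatrix, SimpleGraph.degMatrix, hij, SimpleGraph.adjMatrix_apply]

/-- The design whose blocks are the edges of the path `w 0, …, w n`. -/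
def pathDesign {n : ℕ} (w : Equiv.Perm (Fin (n + 1))) : BinaryDesign (n + 1) 2 where
  numBlocks := n
  block j := {w j.castSucc, w j.succ}
  card_block j := Finset.card_pair fun h => (Fin.castSucc_lt_succ (i := j)).ne (w.injective h)

theorem graph_pathDesign {n : ℕ} (w : Equiv.Perm (Fin (n + 1))) :
    (pathDesign w).graph = (SimpleGraph.pathGraph (n + 1)).map w.toEmbedding := by
  ext a b
  obtain ⟨i, rfl⟩ := w.surjective a
  obtain ⟨j, rfl⟩ := w.surjective b
  have h1 : ((SimpleGraph.pathGraph (n + 1)).map w.toEmbedding).Adj (w i) (w j) ↔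
      (SimpleGraph.pathGraph (n + 1)).Adj i j :=
    SimpleGraph.map_adj_apply (f := w.toEmbedding)
  rw [h1, SimpleGraph.pathGraph_adj]
  simp only [graph, pathDesign, Finset.mem_insert, Finset.mem_singleton, w.injective.eq_iff, ne_eq]
  constructor
  · rintro ⟨hij, l, rfl | rfl, rfl | rfl⟩ <;> simp at hij ⊢
  · rintro (h | h)
    · exact ⟨fun hij => by subst hij; lia, ⟨i, by lia⟩, .inl (Fin.ext rfl),
        .inr (Fin.ext h.symm)⟩
    · exact ⟨fun hij => by subst hij; lia, ⟨j, by lia⟩, .inr (Fin.ext h.symm),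
        .inl (Fin.ext rfl)⟩

theorem pathLaplacian_mem_designLaplacians [NeZero v] (w : Equiv.Perm (Fin v)) :
    pathLaplacian w ∈ designLaplacians v (v - 1) 2 := by
  classical
  obtain ⟨n, rfl⟩ := Nat.exists_eq_succ_of_ne_zero (NeZero.ne v)
  have hgraph := graph_pathDesign w
  have hconn : (pathDesign w).Connected := by
    rw [connected_iff, hgraph]
    exact (SimpleGraph.Iso.map w _).connected_iff.1 (SimpleGraph.pathGraph_connected n)
  refine ⟨pathDesign w, rfl, hconn, ?_⟩
  rw [(isTree_graph hconn rfl).2, pathLaplacian]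
  congr!

end BinaryDesign

/-! ### Optimality criteria -/

open BinaryDesign

variable {v : ℕ}

theorem sum_nontrivialEigenvalues_of_mem {b : ℕ} {L : Matrix (Fin v) (Fin v) ℝ}
    (hL : L ∈ designLaplacians v b 2) : (nontrivialEigenvalues L).sum = 2 * b := by
  obtain ⟨d, rfl, -, rfl⟩ := hL
  rw [sum_nontrivialEigenvalues d.isHermitian_laplacian, d.trace_laplacian]

/-- The trace of the Laplacian matrix depends only on the number of blocks, so that maximizing the
sum of the non-trivial eigenvalues is no restriction. -/
theorem maximalDesignLaplacians_one (v b : ℕ) :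
    maximalDesignLaplacians 1 v b 2 = designLaplacians v b 2 := by
  ext L
  refine ⟨fun h => h.1, fun h => ⟨h, fun j h1 h2 L' hL' => ?_⟩⟩
  obtain rfl : j = 1 := le_antisymm h2 h1
  have h3 := sum_nontrivialEigenvalues_of_mem h
  have h4 := sum_nontrivialEigenvalues_of_mem hL'
  simp [Multiset.esymm, Multiset.powersetCard_one, h3, h4]

theorem nontrivialEigenvalues_informationMatrix [NeZero v] {d e : BinaryDesign v 2} {lam y : ℕ}
    (he : e.IsBIBD lam) {L : Matrix (Fin v) (Fin v) ℝ} (hL : L.IsHermitian)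
    (h1 : L *ᵥ (fun _ => 1) = 0) (hd : d.laplacian = bibdExtension e y L) :
    nontrivialEigenvalues d.informationMatrix =
      (nontrivialEigenvalues L).map fun μ : ℝ => (μ + y * lam * v) / 2 := by
  rw [d.informationMatrix_eq, hd, bibdExtension, he.laplacian_eq, smul_smul,
    nontrivialEigenvalues_half_add hL h1]

theorem prod_inv_half (s : Multiset ℝ) (t : ℝ) :
    ((s.map fun μ => (μ + t) / 2).map fun ρ => ρ⁻¹).prod =
      2 ^ Multiset.card s * (eval t (s.map fun μ => X + C μ).prod)⁻¹ := by
  induction s using Multiset.induction with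
  | empty => simp
  | cons a s ih =>
    simp only [Multiset.map_cons, Multiset.prod_cons, ih, Multiset.card_cons, eval_mul, eval_add,
      eval_X, eval_C, pow_succ, mul_inv, inv_div, add_comm a t]
    rw [div_eq_mul_inv]
    ring

theorem sum_inv_half (s : Multiset ℝ) (t : ℝ) :
    ((s.map fun μ => (μ + t) / 2).map fun ρ => ρ⁻¹).sum = 2 * (s.map fun μ => (μ + t)⁻¹).sum := by
  rw [← Multiset.sum_map_mul_left, Multiset.map_map]
  simp [div_eq_mul_inv]

theorem connected_of_laplacian_eq_bibdExtension [NeZero v] {d e : BinaryDesign v 2} {y : ℕ}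
    {d₀ : BinaryDesign v 2} (h₀ : d₀.Connected) (hd : d.laplacian = bibdExtension e y d₀.laplacian) :
    d.Connected := by
  rw [connected_iff] at h₀ ⊢
  refine h₀.mono fun i j h => ?_
  have hij := h.ne
  rw [graph_adj_iff _ hij] at h ⊢
  rw [hd, bibdExtension, Matrix.add_apply, Matrix.smul_apply, smul_eq_mul]
  -- The off-diagonal entries of Laplacian matrices are non-positive.
  have h1 : d₀.laplacian i j ≤ 0 := by rw [laplacian_apply_of_ne _ hij]; simp
  have h2 : e.laplacian i j ≤ 0 := by rw [laplacian_apply_of_ne _ hij]; simp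
  have h3 : (y : ℝ) * e.laplacian i j ≤ 0 := mul_nonpos_of_nonneg_of_nonpos (by positivity) h2
  exact (add_neg_of_neg_of_nonpos (lt_of_le_of_ne h1 h) h3).ne

theorem mainTheorem2 (v : ℕ) (hv : 2 < v) (e : BinaryDesign v 2) (lam : ℕ) (he : e.IsBIBD lam)
    (w : Equiv.Perm (Fin v)) (y : ℕ) (d : BinaryDesign v 2)
    (hd : d.laplacian = bibdExtension e y (pathLaplacian w)) :
    IsDOptimalAmong (connectedExtendedDesigns (v - 1) e y) d ∧
      (1 ≤ y → IsAOptimalAmong (connectedExtendedDesigns (v - 1) e y) d) := by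
  classical
  have : NeZero v := ⟨by lia⟩
  have hpath := pathLaplacian_mem_designLaplacians w
  have hmem : d ∈ connectedExtendedDesigns (v - 1) e y := by
    refine ⟨?_, pathLaplacian w, by rwa [maximalDesignLaplacians_one], hd⟩
    obtain ⟨d₀, -, hc, h₀⟩ := hpath
    rw [← h₀] at hd
    exact connected_of_laplacian_eq_bibdExtension hc hd
  have hpH := isHermitian_pathLaplacian w
  have hp1 := pathLaplacian_mulVec_one w
  have hpc := card_nontrivialEigenvalues_add_one hpH hp1
  have hsp := sum_nontrivialEigenvalues_of_mem hpath
  have hpp := prod_X_add_eigenvalues_path w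
  have hspec := nontrivialEigenvalues_informationMatrix he hpH hp1 hd
  set t : ℝ := y * lam * v with ht
  have ht0 : 0 ≤ t := by positivity
  -- What is used about a competing design: its Laplacian matrix is that of a tree, extended.
  have hcomp : ∀ d' ∈ connectedExtendedDesigns (v - 1) e y, ∃ s : Multiset ℝ,
      nontrivialEigenvalues d'.informationMatrix = (s.map fun μ => (μ + t) / 2) ∧
      Multiset.card s + 1 = v ∧ s.sum = 2 * (v - 1 : ℕ) ∧
      CoeffLE 1 (s.map fun μ => X + C μ).prod ∧
      CoeffLE (s.map fun μ => X + C μ).prod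
        ((nontrivialEigenvalues (pathLaplacian w)).map fun μ => X + C μ).prod := by
    rintro d' ⟨-, L, hL, hd'⟩
    rw [maximalDesignLaplacians_one] at hL
    have hsum := sum_nontrivialEigenvalues_of_mem hL
    obtain ⟨d₁, hb, hc, rfl⟩ := hL
    have htree := isTree_graph hc hb
    refine ⟨_, nontrivialEigenvalues_informationMatrix he d₁.isHermitian_laplacian
      d₁.laplacian_mulVec_one hd', card_nontrivialEigenvalues_add_one d₁.isHermitian_laplacian
      d₁.laplacian_mulVec_one, hsum, ?_⟩
    rw [hpp, htree.2]
    exact prod_X_add_eigenvalues_tree htree.1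
  refine ⟨⟨hmem, fun d' hd' => ?_⟩, fun hy => ⟨hmem, fun d' hd' => ?_⟩⟩
  · obtain ⟨s, hs, hcard, -, h1, hle⟩ := hcomp d' hd'
    have hcc : Multiset.card (nontrivialEigenvalues (pathLaplacian w)) = Multiset.card s := by lia
    rw [dCriterion, dCriterion, hs, hspec, prod_inv_half, prod_inv_half, hcc]
    have h2 : 1 ≤ eval t (s.map fun μ => X + C μ).prod := by simpa using h1.eval_le ht0
    have h3 := hle.eval_le ht0
    gcongr
  · obtain ⟨s, hs, hcard, hsum, h1, hle⟩ := hcomp d' hd'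
    have hvt : (v : ℝ) ≤ t := by
      have : 1 ≤ y * lam := Nat.mul_pos hy he.pos
      have : (1 : ℝ) ≤ y * lam := by exact_mod_cast this
      rw [ht]
      nlinarith [(Nat.cast_nonneg v : (0 : ℝ) ≤ v)]
    have hv0 : (0 : ℝ) < v := by exact_mod_cast (by lia : 0 < v)
    have hnv : ((v - 1 : ℕ) : ℝ) ≤ v := by exact_mod_cast Nat.sub_le v 1
    have hv1 : (0 : ℝ) ≤ v - 1 := by
      have : (2 : ℝ) < v := by exact_mod_cast hv
      linarith
    rw [aCriterion, aCriterion, hs, hspec, sum_inv_half, sum_inv_half]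
    refine div_le_div_of_nonneg_right (mul_le_mul_of_nonneg_left ?_ zero_le_two) hv1
    exact sum_inv_add_le (n := v - 1) (by lia) (by lia) hsum hsp h1 hle (hv0.trans_le hvt)
      (hnv.trans hvt)
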